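/- There are universal constants $C>0$ and $k\in\mathbb N$ such that the following holds for every $n\ge 1$ and every convex body $K\subseteq\mathbb R^n$ (a compact convex set with non-empty interior). There is a measurable set $A\subseteq K$ with $\mathrm{vol}(A)/\mathrm{vol}(K)=1/2$ such that $$\left|\,\mathbb P\left(\frac{\mathrm{length}(L\cap A)}{\mathrm{length}(L\cap K)}\in\{0,1\}\right)-1\,\right|\le C\,\frac{(1+\log n)^k}{\sqrt n},$$ where $L=X+\mathbb R\theta$, and $X$ and $\theta$ are independent random vectors, distributed uniformly in $K$ and on the unit sphere $S^{n-1}$, respectively. In other words, this probability equals $1-O^*(1/\sqrt n)$, uniformly in $K$, where $O^*$ is big-O notation up to logarithmic factors. -/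

import Mathlib

open MeasureTheory

/-- Euclidean space `ℝⁿ`. -/
abbrev RSpace (n : ℕ) : Type := EuclideanSpace ℝ (Fin n)

/-- The unit sphere `Sⁿ⁻¹` in `ℝⁿ`. -/
abbrev UnitSphere (n : ℕ) : Type := Metric.sphere (0 : RSpace n) 1

/-- The line `x + ℝθ`. -/
def lineThrough {n : ℕ} (x θ : RSpace n) : Set (RSpace n) :=
  Set.range fun t : ℝ => x + t • θ

/-- The length of a subset of a line: its one-dimensional Hausdorff measure. -/
noncomputable def length {n : ℕ} (S : Set (RSpace n)) : ENNReal :=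
  Measure.hausdorffMeasure 1 S

/-- The uniform probability distribution on a set `K ⊆ ℝⁿ` of positive finite volume:
`B ↦ vol (K ∩ B) / vol K`. -/
noncomputable def uniformBody {n : ℕ} (K : Set (RSpace n)) : Measure (RSpace n) :=
  ProbabilityTheory.cond volume K

/-- The uniform probability distribution on the unit sphere: the surface measure, normalized. -/
noncomputable def uniformSphere (n : ℕ) : Measure (UnitSphere n) :=
  ProbabilityTheory.cond (volume : Measure (RSpace n)).toSphere Set.univ

/-- The law of the pair `(X, θ)`, with `X` uniform in `K` and `θ` uniform on the sphere,
independent of each other. -/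
noncomputable def hitAndRunLaw {n : ℕ} (K : Set (RSpace n)) :
    Measure (RSpace n × UnitSphere n) :=
  (uniformBody K).prod (uniformSphere n)

/-- The pairs `(x, θ)` for which the fraction of `L ∩ K` lying in `A`, where `L = x + ℝθ`,
is `0` or `1`. -/
def zeroOneEvent {n : ℕ} (K A : Set (RSpace n)) : Set (RSpace n × UnitSphere n) :=
  {p | length (lineThrough p.1 p.2 ∩ A) / length (lineThrough p.1 p.2 ∩ K)
    ∈ ({0, 1} : Set ENNReal)}

/-!
The set `A` is the part of `K` on one side of a hyperplane `⟪e, ·⟫ = t` that halves the volume.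
The direction `e` is the one in which `K` is most spread out. Spread is measured by
`concentration K θ`, the largest density of `⟪θ, X⟫`, and `e` minimizes it up to a factor `2`
(`exists_direction`); no moment or isotropy is used. Let `m` be its value at `e`. The small-ball
bound `ℙ(⟪e, X⟫ ∈ [t, t + s)) ≤ m s` then holds by definition.

In the other direction, every unit `θ` has a slab of width `s` whose mass is at least `m s / 2`.
Translating `K` by `s • θ` moves at least the mass of such a slab out of `K`
(`uniformBody_slab_add_le_one`), so `g(r) = ℙ(X + r θ ∈ K)` satisfies `g(s) ≤ 1 - m s / 2`. The
Brunn–Minkowski inequality gives `g(2r) ≤ g(r)²` (`uniformBody_add_two_smul_le_sq`), whence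
`g(r) ≤ exp(-m r / 4)` for `r ≥ 2 / m` (`uniformBody_add_smul_le_exp`): for every `θ`, the chord of
`K` through `X` in the direction `θ` has length of order at most `1 / m`, with an exponential tail.

With `r = 4 (1 + log n) / m`, the chord through `X` therefore stays within distance `r` of `X`,
outside an event of probability at most `2 / √n`. Over that distance the height `⟪e, ·⟫` changes by
at most `r |⟪e, θ⟫|`, and `𝔼 |⟪e, θ⟫| ≤ 1 / √n`. The hyperplane cuts the chord only if
`⟪e, X⟫` is that close to `t` (`mem_zeroOneEvent`), which has probability at most
`2 m r / √n = 8 (1 + log n) / √n`.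

Brunn–Minkowski is needed only for midpoints and in its multiplicative form. It is obtained from
the midpoint Prékopa–Leindler inequality, which holds on the line by comparison of superlevel sets
and passes to products by Fubini.
-/

/-! ### The midpoint Prékopa–Leindler inequality -/

theorem Real.volume_add_volume_le_of_isCompact {A B C : Set ℝ} (hA : IsCompact A)
    (hB : IsCompact B) (hA' : A.Nonempty) (hB' : B.Nonempty)
    (h : ∀ a ∈ A, ∀ b ∈ B, (1 / 2 : ℝ) * (a + b) ∈ C) :
    volume A + volume B ≤ 2 * volume C := by
  have hM := hA.sSup_mem hA'
  have hm := hB.sInf_mem hB'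
  set M := sSup A
  set m := sInf B
  have hC : volume (((1 / 2 : ℝ) * ·) ⁻¹' C) = 2 * volume C := by
    rw [Real.volume_preimage_mul_left (by norm_num)]
    norm_num
  have h1 : volume ((· + m) '' A) = volume A := by simp
  have h2 : volume ((M + ·) '' B) = volume B := by simp
  have hd : AEDisjoint volume ((· + m) '' A) ((M + ·) '' B) := by
    refine measure_mono_null (t := {M + m}) ?_ (by simp)
    rintro x ⟨⟨a, ha, rfl⟩, ⟨b, hb, hab⟩⟩
    have h3 : a ≤ M := le_csSup hA.bddAbove ha
    have h4 : m ≤ b := csInf_le hB.bddBelow hb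
    simp only [Set.mem_singleton_iff] at *
    linarith
  have hmeas : MeasurableSet ((M + ·) '' B) :=
    (hB.image (by fun_prop)).isClosed.measurableSet
  rw [← hC, ← h1, ← h2, ← measure_union₀ hmeas.nullMeasurableSet hd]
  refine measure_mono (Set.union_subset ?_ ?_)
  · rintro _ ⟨a, ha, rfl⟩
    exact h a ha m hm
  · rintro _ ⟨b, hb, rfl⟩
    exact h M hM b hb

/-- The Brunn–Minkowski inequality on the line, for midpoints. -/
theorem Real.volume_add_volume_le {A B C : Set ℝ} (hA : MeasurableSet A)
    (hB : MeasurableSet B) (hA' : A.Nonempty) (hB' : B.Nonempty)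
    (h : ∀ a ∈ A, ∀ b ∈ B, (1 / 2 : ℝ) * (a + b) ∈ C) :
    volume A + volume B ≤ 2 * volume C := by
  obtain ⟨a₀, ha₀⟩ := hA'
  obtain ⟨b₀, hb₀⟩ := hB'
  rw [hA.measure_eq_iSup_isCompact, hB.measure_eq_iSup_isCompact]
  simp only [iSup_and']
  refine ENNReal.biSup_add_biSup_le' ⟨∅, by simp⟩ ⟨∅, by simp⟩ ?_
  rintro K ⟨hKA, hK⟩ L ⟨hLB, hL⟩
  calc volume K + volume L ≤ volume (insert a₀ K) + volume (insert b₀ L) := by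
        gcongr <;> exact Set.subset_insert _ _
    _ ≤ 2 * volume C :=
        Real.volume_add_volume_le_of_isCompact (hK.insert a₀) (hL.insert b₀) ⟨a₀, by simp⟩
          ⟨b₀, by simp⟩ fun a ha b hb =>
            h a (Set.insert_subset ha₀ hKA ha) b (Set.insert_subset hb₀ hLB hb)

/-- The Prékopa–Leindler inequality with weights `1 / 2` and `1 / 2`, as a property of a
measure `μ` on a real vector space. -/
def MidpointPrekopaLeindler {E : Type*} [AddCommGroup E] [Module ℝ E] [MeasurableSpace E]
    (μ : Measure E) : Prop :=
  ∀ f g h : E → ENNReal, Measurable f → Measurable g → Measurable h →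
    (∀ x y, f x * g y ≤ h ((1 / 2 : ℝ) • (x + y)) ^ 2) →
      (∫⁻ x, f x ∂μ) * ∫⁻ x, g x ∂μ ≤ (∫⁻ x, h x ∂μ) ^ 2

theorem lintegral_ofReal_eq_setLIntegral_Ioo {f : ℝ → ℝ} (hf : Measurable f) (h0 : ∀ x, 0 ≤ f x)
    (h1 : ∀ x, f x ≤ 1) :
    ∫⁻ x, ENNReal.ofReal (f x) = ∫⁻ t in Set.Ioo (0 : ℝ) 1, volume {x | t < f x} := by
  rw [lintegral_eq_lintegral_meas_lt volume (Filter.Eventually.of_forall h0) hf.aemeasurable]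
  rw [← Set.Ioo_union_Ici_eq_Ioi (zero_lt_one (α := ℝ)),
    lintegral_union measurableSet_Ici]
  · rw [setLIntegral_congr_fun (s := Set.Ici 1) (g := fun _ => 0) measurableSet_Ici]
    · simp
    · intro t ht
      have : {x | t < f x} = ∅ := by
        ext x
        simpa using (h1 x).trans ht
      simp [this]
  · exact Set.disjoint_left.2 fun x hx hx' => absurd hx.2 (not_lt.2 hx')

/-- The arithmetic-mean form of the Prékopa–Leindler inequality on the line, for functions
whose suprema are both equal to `1`: compare superlevel sets at equal heights. -/
theorem lintegral_add_lintegral_le_of_sup_eq_one {f g h : ℝ → ℝ} (hf : Measurable f)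
    (hg : Measurable g) (hh : Measurable h) (f0 : ∀ x, 0 ≤ f x) (g0 : ∀ x, 0 ≤ g x)
    (h0 : ∀ x, 0 ≤ h x) (f1 : ∀ x, f x ≤ 1) (g1 : ∀ x, g x ≤ 1)
    (fs : ∀ t ∈ Set.Ioo (0 : ℝ) 1, ∃ x, t < f x) (gs : ∀ t ∈ Set.Ioo (0 : ℝ) 1, ∃ x, t < g x)
    (hfg : ∀ x y, f x * g y ≤ h ((1 / 2 : ℝ) * (x + y)) ^ 2) :
    (∫⁻ x, ENNReal.ofReal (f x)) + ∫⁻ x, ENNReal.ofReal (g x)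
      ≤ 2 * ∫⁻ x, ENNReal.ofReal (h x) := by
  rw [lintegral_ofReal_eq_setLIntegral_Ioo hf f0 f1, lintegral_ofReal_eq_setLIntegral_Ioo hg g0 g1,
    lintegral_eq_lintegral_meas_lt volume (Filter.Eventually.of_forall h0) hh.aemeasurable]
  have anti : ∀ u : ℝ → ℝ, Antitone fun t : ℝ => volume {x | t < u x} := fun u s t hst =>
    measure_mono fun x hx => hst.trans_lt hx
  rw [← lintegral_add_left (anti f).measurable, ← lintegral_const_mul _ (anti h).measurable]
  refine (setLIntegral_mono_ae (Measurable.aemeasurable ((anti h).measurable.const_mul 2))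
    (Filter.Eventually.of_forall fun t ht => ?_)).trans
    (lintegral_mono_set (Set.Ioo_subset_Ioi_self))
  refine Real.volume_add_volume_le (measurableSet_lt measurable_const hf)
    (measurableSet_lt measurable_const hg) (fs t ht) (gs t ht) fun a ha b hb => ?_
  simp only [Set.mem_ofPred_eq] at *
  refine lt_of_pow_lt_pow_left₀ 2 (h0 _) (lt_of_lt_of_le ?_ (hfg a b))
  nlinarith [ht.1]

theorem ENNReal.mul_le_sq_of_add_le_two_mul {a b c : ENNReal} (h : a + b ≤ 2 * c) :
    a * b ≤ c ^ 2 := by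
  rcases eq_or_ne c ⊤ with hc | hc
  · simp [hc]
  have hab : a + b ≠ ⊤ := ne_top_of_le_ne_top (ENNReal.mul_ne_top (by simp) hc) h
  lift a to NNReal using fun h => hab (by simp [h])
  lift b to NNReal using fun h => hab (by simp [h])
  lift c to NNReal using hc
  norm_cast at h ⊢
  have h' : (a : ℝ) + b ≤ 2 * c := by exact_mod_cast h
  have : (a : ℝ) * b ≤ (c : ℝ) ^ 2 := by
    nlinarith [sq_nonneg ((a : ℝ) - b), a.coe_nonneg, b.coe_nonneg, c.coe_nonneg]
  exact_mod_cast this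

theorem exists_lt_toReal_div_toReal_iSup {ι : Type*} {f : ι → ENNReal} {a : ENNReal}
    (ha : a = ⨆ x, f x) (ha0 : a ≠ 0) (ha_top : a ≠ ⊤) {t : ℝ} (ht : t ∈ Set.Ioo (0 : ℝ) 1) :
    ∃ x, t < (f x).toReal / a.toReal := by
  have ha_pos : 0 < a.toReal := ENNReal.toReal_pos ha0 ha_top
  have h1 : ENNReal.ofReal (t * a.toReal) < a := by
    rw [ENNReal.ofReal_lt_iff_lt_toReal (by have := ht.1; positivity) ha_top]
    nlinarith [ht.2]
  obtain ⟨x, hx⟩ := lt_iSup_iff.1 (ha ▸ h1 : ENNReal.ofReal (t * a.toReal) < ⨆ x, f x)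
  have hxa : f x ≤ a := ha ▸ le_iSup f x
  exact ⟨x, (lt_div_iff₀ ha_pos).2 ((ENNReal.ofReal_lt_iff_lt_toReal
    (by have := ht.1; positivity) (ne_top_of_le_ne_top ha_top hxa)).1 hx)⟩

/-- The one-dimensional inequality for bounded functions: normalize both suprema to `1`, then
pass from the arithmetic to the geometric mean of the integrals. -/
theorem lintegral_mul_lintegral_le_sq_of_bounded {f g h : ℝ → ENNReal} (hf : Measurable f)
    (hg : Measurable g) (hh : Measurable h) {N : ENNReal} (hN : N ≠ ⊤) (fN : ∀ x, f x ≤ N)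
    (gN : ∀ x, g x ≤ N)
    (hfg : ∀ x y, f x * g y ≤ h ((1 / 2 : ℝ) • (x + y)) ^ 2) :
    (∫⁻ x, f x) * ∫⁻ x, g x ≤ (∫⁻ x, h x) ^ 2 := by
  obtain ⟨a, ha⟩ : ∃ a, a = ⨆ x, f x := ⟨_, rfl⟩
  obtain ⟨b, hb⟩ : ∃ b, b = ⨆ x, g x := ⟨_, rfl⟩
  have fa : ∀ x, f x ≤ a := fun x => ha ▸ le_iSup f x
  have gb : ∀ x, g x ≤ b := fun x => hb ▸ le_iSup g x
  have ha_top : a ≠ ⊤ := ne_top_of_le_ne_top hN (ha ▸ iSup_le fN)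
  have hb_top : b ≠ ⊤ := ne_top_of_le_ne_top hN (hb ▸ iSup_le gN)
  rcases eq_or_ne a 0 with ha0 | ha0
  · have : ∀ x, f x = 0 := fun x => by simpa [ha0] using fa x
    simp [this]
  rcases eq_or_ne b 0 with hb0 | hb0
  · have : ∀ x, g x = 0 := fun x => by simpa [hb0] using gb x
    simp [this]
  have ha_pos : 0 < a.toReal := ENNReal.toReal_pos ha0 ha_top
  have hb_pos : 0 < b.toReal := ENNReal.toReal_pos hb0 hb_top
  -- the common scale of `h` is the geometric mean of the two suprema
  set c : ℝ := √(a.toReal * b.toReal) with hc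
  have hc_pos : 0 < c := Real.sqrt_pos.2 (mul_pos ha_pos hb_pos)
  have hc2 : c ^ 2 = a.toReal * b.toReal := Real.sq_sqrt (by positivity)
  have hab : a * b = ENNReal.ofReal c ^ 2 := by
    rw [← ENNReal.ofReal_pow hc_pos.le, hc2, ENNReal.ofReal_mul ha_pos.le,
      ENNReal.ofReal_toReal ha_top, ENNReal.ofReal_toReal hb_top]
  have key := lintegral_add_lintegral_le_of_sup_eq_one
    (f := fun x => (f x).toReal / a.toReal) (g := fun x => (g x).toReal / b.toReal)
    (h := fun x => (min (h x) (ENNReal.ofReal c)).toReal / c)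
    (hf.ennreal_toReal.div_const _) (hg.ennreal_toReal.div_const _)
    ((hh.min measurable_const).ennreal_toReal.div_const _)
    (fun x => by positivity) (fun x => by positivity) (fun x => by positivity)
    (fun x => (div_le_one ha_pos).2 (ENNReal.toReal_mono ha_top (fa x)))
    (fun x => (div_le_one hb_pos).2 (ENNReal.toReal_mono hb_top (gb x)))
    ?_ ?_ ?_
  · have fe : ∀ x, f x = a * ENNReal.ofReal ((f x).toReal / a.toReal) := fun x => by
      rw [← ENNReal.ofReal_toReal ha_top, ← ENNReal.ofReal_mul ENNReal.toReal_nonneg,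
        ENNReal.toReal_ofReal ha_pos.le, mul_div_cancel₀ _ ha_pos.ne',
        ENNReal.ofReal_toReal (ne_top_of_le_ne_top ha_top (fa x))]
    have ge : ∀ x, g x = b * ENNReal.ofReal ((g x).toReal / b.toReal) := fun x => by
      rw [← ENNReal.ofReal_toReal hb_top, ← ENNReal.ofReal_mul ENNReal.toReal_nonneg,
        ENNReal.toReal_ofReal hb_pos.le, mul_div_cancel₀ _ hb_pos.ne',
        ENNReal.ofReal_toReal (ne_top_of_le_ne_top hb_top (gb x))]
    have he : ∀ x, ENNReal.ofReal c *
        ENNReal.ofReal ((min (h x) (ENNReal.ofReal c)).toReal / c) ≤ h x := fun x => by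
      rw [← ENNReal.ofReal_mul hc_pos.le, mul_div_cancel₀ _ hc_pos.ne',
        ENNReal.ofReal_toReal (ne_top_of_le_ne_top ENNReal.ofReal_ne_top (min_le_right _ _))]
      exact min_le_left _ _
    set F := ∫⁻ x, ENNReal.ofReal ((f x).toReal / a.toReal)
    set G := ∫⁻ x, ENNReal.ofReal ((g x).toReal / b.toReal)
    set H := ∫⁻ x, ENNReal.ofReal ((min (h x) (ENNReal.ofReal c)).toReal / c)
    have hF : ∫⁻ x, f x = a * F := by
      rw [← lintegral_const_mul' _ _ ha_top]; exact lintegral_congr fe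
    have hG : ∫⁻ x, g x = b * G := by
      rw [← lintegral_const_mul' _ _ hb_top]; exact lintegral_congr ge
    have hH : ENNReal.ofReal c * H ≤ ∫⁻ x, h x := by
      rw [← lintegral_const_mul' _ _ ENNReal.ofReal_ne_top]; exact lintegral_mono he
    have hFG : F * G ≤ H ^ 2 := ENNReal.mul_le_sq_of_add_le_two_mul key
    calc (∫⁻ x, f x) * ∫⁻ x, g x = (a * b) * (F * G) := by rw [hF, hG]; ring
      _ ≤ (a * b) * H ^ 2 := by gcongr
      _ = (ENNReal.ofReal c * H) ^ 2 := by rw [hab]; ring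
      _ ≤ _ := by gcongr
  · exact fun t ht => exists_lt_toReal_div_toReal_iSup ha ha0 ha_top ht
  · exact fun t ht => exists_lt_toReal_div_toReal_iSup hb hb0 hb_top ht
  · intro x y
    have h1 : f x * g y ≤ min (h ((1 / 2 : ℝ) * (x + y))) (ENNReal.ofReal c) ^ 2 := by
      rcases min_choice (h ((1 / 2 : ℝ) * (x + y))) (ENNReal.ofReal c) with e | e <;> rw [e]
      · exact hfg x y
      · rw [← hab]
        exact mul_le_mul' (fa x) (gb y)
    have h2 := ENNReal.toReal_mono (ENNReal.pow_ne_top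
      (ne_top_of_le_ne_top ENNReal.ofReal_ne_top (min_le_right _ _))) h1
    rw [ENNReal.toReal_mul, ENNReal.toReal_pow] at h2
    rw [div_mul_div_comm, div_pow, hc2]
    gcongr

theorem midpointPrekopaLeindler_real : MidpointPrekopaLeindler (volume : Measure ℝ) := by
  intro f g h hf hg hh hfg
  have mono : ∀ u : ℝ → ENNReal, Monotone fun (N : ℕ) x => min (u x) (N : ENNReal) :=
    fun u M N hMN x => min_le_min_left _ (by exact_mod_cast hMN)
  have trunc : ∀ u : ℝ → ENNReal, Measurable u →
      Filter.Tendsto (fun N : ℕ => ∫⁻ x, min (u x) (N : ENNReal)) Filter.atTop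
        (nhds (∫⁻ x, u x)) := by
    intro u hu
    refine lintegral_tendsto_of_tendsto_of_monotone
      (fun N => (hu.min measurable_const).aemeasurable)
      (Filter.Eventually.of_forall fun x M N hMN => mono u hMN x)
      (Filter.Eventually.of_forall fun x => ?_)
    simpa using (tendsto_const_nhds (x := u x)).min ENNReal.tendsto_nat_nhds_top
  have key : ∀ N : ℕ, (∫⁻ x, min (f x) (N : ENNReal)) * ∫⁻ x, min (g x) (N : ENNReal)
      ≤ (∫⁻ x, h x) ^ 2 := fun N =>
    lintegral_mul_lintegral_le_sq_of_bounded (hf.min measurable_const) (hg.min measurable_const)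
      hh (ENNReal.natCast_ne_top N) (fun x => min_le_right _ _) (fun x => min_le_right _ _)
      fun x y => (mul_le_mul' (min_le_left _ _) (min_le_left _ _)).trans (hfg x y)
  rcases eq_or_ne (∫⁻ x, f x) 0 with h0 | h0
  · simp [h0]
  rcases eq_or_ne (∫⁻ x, g x) 0 with h1 | h1
  · simp [h1]
  exact le_of_tendsto (ENNReal.Tendsto.mul (trunc f hf) (Or.inl h0) (trunc g hg) (Or.inl h1))
    (Filter.Eventually.of_forall key)

theorem MidpointPrekopaLeindler.prod {E F : Type*} [AddCommGroup E] [Module ℝ E]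
    [MeasurableSpace E] [AddCommGroup F] [Module ℝ F] [MeasurableSpace F] {μ : Measure E}
    {ν : Measure F} [SFinite μ] [SFinite ν] (hμ : MidpointPrekopaLeindler μ)
    (hν : MidpointPrekopaLeindler ν) : MidpointPrekopaLeindler (μ.prod ν) := by
  intro f g h hf hg hh hfg
  rw [lintegral_prod _ hf.aemeasurable, lintegral_prod _ hg.aemeasurable,
    lintegral_prod _ hh.aemeasurable]
  refine hμ _ _ _ hf.lintegral_prod_right' hg.lintegral_prod_right' hh.lintegral_prod_right'
    fun x x' => ?_
  exact hν _ _ _ (hf.comp measurable_prodMk_left) (hg.comp measurable_prodMk_left)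
    (hh.comp measurable_prodMk_left) fun y y' => hfg (x, y) (x', y')

/-- The inequality is carried over by a measure-preserving linear bijection. -/
theorem MidpointPrekopaLeindler.of_measurePreserving {E F : Type*} [AddCommGroup E] [Module ℝ E]
    [MeasurableSpace E] [AddCommGroup F] [Module ℝ F] [MeasurableSpace F] {μ : Measure E}
    {ν : Measure F} (hμ : MidpointPrekopaLeindler μ) (T : E →ₗ[ℝ] F)
    (hT : MeasurePreserving T μ ν) : MidpointPrekopaLeindler ν := by
  intro f g h hf hg hh hfg
  rw [← hT.lintegral_comp hf, ← hT.lintegral_comp hg, ← hT.lintegral_comp hh]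
  refine hμ _ _ _ (hf.comp hT.measurable) (hg.comp hT.measurable) (hh.comp hT.measurable)
    fun x y => ?_
  simpa using hfg (T x) (T y)

theorem midpointPrekopaLeindler_pi (n : ℕ) :
    MidpointPrekopaLeindler (volume : Measure (Fin n → ℝ)) := by
  induction n with
  | zero =>
    intro f g h hf hg hh hfg
    have := hfg 0 0
    rw [Measure.volume_pi_eq_dirac (0 : Fin 0 → ℝ)]
    simpa using this
  | succ n ih =>
    let T : (ℝ × (Fin n → ℝ)) →ₗ[ℝ] (Fin (n + 1) → ℝ) :=
      { toFun := (MeasurableEquiv.piFinSuccAbove (fun _ : Fin (n + 1) => ℝ) 0).symm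
        map_add' := fun x y => by
          ext i
          refine Fin.cases ?_ (fun j => ?_) i <;> simp [MeasurableEquiv.piFinSuccAbove]
        map_smul' := fun c x => by
          ext i
          refine Fin.cases ?_ (fun j => ?_) i <;> simp [MeasurableEquiv.piFinSuccAbove] }
    exact (midpointPrekopaLeindler_real.prod ih).of_measurePreserving T
      (volume_preserving_piFinSuccAbove (fun _ : Fin (n + 1) => ℝ) 0).symm

theorem midpointPrekopaLeindler_rspace (n : ℕ) :
    MidpointPrekopaLeindler (volume : Measure (RSpace n)) :=
  (midpointPrekopaLeindler_pi n).of_measurePreserving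
    (WithLp.linearEquiv 2 ℝ (Fin n → ℝ)).symm.toLinearMap
    (PiLp.volume_preserving_toLp (Fin n))

/-- The Brunn–Minkowski inequality in its dimension-free form, for midpoints. -/
theorem volume_mul_volume_le_sq {n : ℕ} {A B C : Set (RSpace n)} (hA : MeasurableSet A)
    (hB : MeasurableSet B) (hC : MeasurableSet C)
    (h : ∀ a ∈ A, ∀ b ∈ B, (1 / 2 : ℝ) • (a + b) ∈ C) :
    volume A * volume B ≤ volume C ^ 2 := by
  have := midpointPrekopaLeindler_rspace n (A.indicator 1) (B.indicator 1) (C.indicator 1)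
    (measurable_one.indicator hA) (measurable_one.indicator hB) (measurable_one.indicator hC) ?_
  · simpa [lintegral_indicator_one hA, lintegral_indicator_one hB, lintegral_indicator_one hC]
      using this
  · intro a b
    by_cases ha : a ∈ A
    · by_cases hb : b ∈ B
      · simp only [Set.indicator_of_mem ha, Set.indicator_of_mem hb,
          Set.indicator_of_mem (h a ha b hb)]
        simp
      · simp [hb]
    · simp [ha]

/-! ### The uniform distribution on a body, translates and slabs -/

theorem uniformBody_real_apply {n : ℕ} {K : Set (RSpace n)} (hK : MeasurableSet K)
    (s : Set (RSpace n)) :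
    (uniformBody K).real s = (volume.real K)⁻¹ * volume.real (K ∩ s) := by
  rw [measureReal_def, uniformBody, ProbabilityTheory.cond_apply hK, ENNReal.toReal_mul,
    ENNReal.toReal_inv]
  rfl

theorem isProbabilityMeasure_uniformBody {n : ℕ} {K : Set (RSpace n)} (hK : IsCompact K)
    (h0 : volume K ≠ 0) : IsProbabilityMeasure (uniformBody K) :=
  ProbabilityTheory.cond_isProbabilityMeasure_of_finite h0 hK.measure_lt_top.ne

/-- The slab of the points whose component in the direction `θ` lies in `[t, t + s)`. -/
def slab {n : ℕ} (θ : RSpace n) (t s : ℝ) : Set (RSpace n) :=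
  {x | inner ℝ θ x ∈ Set.Ico t (t + s)}

theorem measurableSet_slab {n : ℕ} (θ : RSpace n) (t s : ℝ) : MeasurableSet (slab θ t s) :=
  (by fun_prop : Measurable fun x : RSpace n => inner ℝ θ x) measurableSet_Ico

theorem measurableSet_add_mem {n : ℕ} {K : Set (RSpace n)} (hK : MeasurableSet K) (v : RSpace n) :
    MeasurableSet {x | x + v ∈ K} :=
  (measurable_add_const v) hK

/-- A translation by `s • θ` pushes out of `K` at least as much mass as a slab of width `s`
orthogonal to `θ` carries: the points of `K` above height `t` that stay in `K` are carried above
height `t + s`. -/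
theorem uniformBody_slab_add_le_one {n : ℕ} {K : Set (RSpace n)} (hK : IsCompact K)
    (h0 : volume K ≠ 0) {θ : RSpace n} (hθ : ‖θ‖ = 1) (t s : ℝ) (hs : 0 ≤ s) :
    (uniformBody K).real (slab θ t s) + (uniformBody K).real {x | x + s • θ ∈ K} ≤ 1 := by
  have hKm := hK.measurableSet
  have hfin : ∀ s : Set (RSpace n), volume (K ∩ s) ≠ ⊤ := fun s =>
    ne_top_of_le_ne_top hK.measure_lt_top.ne (measure_mono Set.inter_subset_left)
  have hpos : 0 < volume.real K := ENNReal.toReal_pos h0 hK.measure_lt_top.ne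
  have hin : Measurable fun x : RSpace n => inner ℝ θ x := by fun_prop
  have key : volume (K ∩ slab θ t s) + volume (K ∩ {x | x + s • θ ∈ K}) ≤ volume K := by
    set U : Set (RSpace n) := {x | t ≤ inner ℝ θ x}
    set V : Set (RSpace n) := {x | t + s ≤ inner ℝ θ x}
    have hU : MeasurableSet U := measurableSet_le measurable_const hin
    have hV : MeasurableSet V := measurableSet_le measurable_const hin
    have h1 : volume (K ∩ {x | x + s • θ ∈ K} ∩ U) ≤ volume (K ∩ V) := by
      rw [← measure_preimage_add_right volume (s • θ) (K ∩ V)]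
      refine measure_mono ?_
      rintro x ⟨⟨hx, hxK⟩, hxU⟩
      refine ⟨hxK, ?_⟩
      simp only [U, V, Set.mem_ofPred_eq, inner_add_right, inner_smul_right,
        real_inner_self_eq_norm_sq, hθ] at *
      linarith
    have h2 : volume (K ∩ slab θ t s) + volume (K ∩ V) = volume (K ∩ U) := by
      rw [← measure_inter_add_sdiff (K ∩ U) hV, add_comm]
      congr 2 <;> ext x <;>
        simp only [U, V, slab, Set.mem_inter_iff, Set.mem_sdiff, Set.mem_ofPred_eq,
          Set.mem_Ico, not_le]
      · constructor
        · rintro ⟨h, h'⟩; exact ⟨⟨h, by linarith⟩, h'⟩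
        · rintro ⟨⟨h, -⟩, h'⟩; exact ⟨h, h'⟩
      · tauto
    calc volume (K ∩ slab θ t s) + volume (K ∩ {x | x + s • θ ∈ K})
        = volume (K ∩ slab θ t s) + (volume (K ∩ {x | x + s • θ ∈ K} ∩ U)
            + volume ((K ∩ {x | x + s • θ ∈ K}) \ U)) := by
          rw [measure_inter_add_sdiff _ hU]
      _ ≤ volume (K ∩ slab θ t s) + (volume (K ∩ V) + volume (K \ U)) := by
          gcongr
          exact Set.inter_subset_left
      _ = volume K := by
          rw [← add_assoc, h2, measure_inter_add_sdiff _ hU]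
  rw [uniformBody_real_apply hKm, uniformBody_real_apply hKm, ← mul_add,
    inv_mul_le_iff₀ hpos, mul_one]
  have := ENNReal.toReal_mono hK.measure_lt_top.ne key
  rwa [ENNReal.toReal_add (hfin _) (hfin _)] at this

/-- The probability that a translate of a uniform point stays in the body decays at least
geometrically in the length of the translation, by the Brunn–Minkowski inequality. -/
theorem uniformBody_add_two_smul_le_sq {n : ℕ} {K : Set (RSpace n)} (hK : IsCompact K)
    (hc : Convex ℝ K) (h0 : volume K ≠ 0) (v : RSpace n) :
    (uniformBody K).real {x | x + (2 : ℝ) • v ∈ K} ≤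
      (uniformBody K).real {x | x + v ∈ K} ^ 2 := by
  have hKm := hK.measurableSet
  have hfin : ∀ s : Set (RSpace n), volume (K ∩ s) ≠ ⊤ := fun s =>
    ne_top_of_le_ne_top hK.measure_lt_top.ne (measure_mono Set.inter_subset_left)
  have hpos : 0 < volume.real K := ENNReal.toReal_pos h0 hK.measure_lt_top.ne
  have key : volume (K ∩ {x | x + (2 : ℝ) • v ∈ K}) * volume K
      ≤ volume (K ∩ {x | x + v ∈ K}) ^ 2 := by
    refine volume_mul_volume_le_sq (hKm.inter (measurableSet_add_mem hKm _)) hKm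
      (hKm.inter (measurableSet_add_mem hKm _)) ?_
    rintro x ⟨hx, hxv⟩ y hy
    have hmid : ∀ a ∈ K, ∀ b ∈ K, (1 / 2 : ℝ) • (a + b) ∈ K := fun a ha b hb => by
      rw [smul_add]
      exact hc ha hb (by norm_num) (by norm_num) (by norm_num)
    refine ⟨hmid x hx y hy, ?_⟩
    have := hmid _ hxv y hy
    have e : (1 / 2 : ℝ) • (x + (2 : ℝ) • v + y) = (1 / 2 : ℝ) • (x + y) + v := by module
    rwa [e] at this
  have := ENNReal.toReal_mono (ENNReal.pow_ne_top (hfin _)) key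
  rw [ENNReal.toReal_mul, ENNReal.toReal_pow] at this
  rw [uniformBody_real_apply hKm, uniformBody_real_apply hKm, mul_pow, inv_pow,
    inv_mul_le_iff₀ hpos, ← mul_assoc, ← div_eq_mul_inv]
  rw [show volume.real K / volume.real K ^ 2 = (volume.real K)⁻¹ by field_simp, ← div_eq_inv_mul,
    le_div_iff₀ hpos]
  exact this

theorem uniformBody_add_smul_anti {n : ℕ} {K : Set (RSpace n)} (hK : IsCompact K)
    (hc : Convex ℝ K) (v : RSpace n) {a b : ℝ} (ha : 0 ≤ a) (hab : a ≤ b) :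
    (uniformBody K).real {x | x + b • v ∈ K} ≤ (uniformBody K).real {x | x + a • v ∈ K} := by
  have hKm := hK.measurableSet
  rw [uniformBody_real_apply hKm, uniformBody_real_apply hKm]
  refine mul_le_mul_of_nonneg_left (measureReal_mono ?_ ?_) (by positivity)
  · rintro x ⟨hx, hxb⟩
    refine ⟨hx, ?_⟩
    rcases hab.eq_or_lt with rfl | hlt
    · exact hxb
    have hb : 0 < b := ha.trans_lt hlt
    have := hc.add_smul_mem hx hxb (t := a / b) ⟨by positivity, (div_le_one hb).2 hab⟩
    rwa [smul_smul, div_mul_cancel₀ _ hb.ne'] at this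
  · exact ne_top_of_le_ne_top hK.measure_lt_top.ne (measure_mono Set.inter_subset_left)

/-- If some slab orthogonal to `θ` has average density at least `m / 2`, then the distance from a
uniform point to the boundary in the direction `θ` has an exponential tail on the scale `1 / m`. -/
theorem uniformBody_add_smul_le_exp {n : ℕ} {K : Set (RSpace n)} (hK : IsCompact K)
    (hc : Convex ℝ K) (h0 : volume K ≠ 0) {θ : RSpace n} (hθ : ‖θ‖ = 1) {m t s r : ℝ} (hm : 0 < m)
    (hs : 0 < s) (hslab : m / 2 * s ≤ (uniformBody K).real (slab θ t s)) (hr : 2 / m ≤ r) :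
    (uniformBody K).real {x | x + r • θ ∈ K} ≤ Real.exp (-(m * r / 4)) := by
  have hsum := uniformBody_slab_add_le_one hK h0 hθ t s hs.le
  have hpow : ∀ j : ℕ, (uniformBody K).real {x | x + ((2 : ℝ) ^ j * s) • θ ∈ K}
      ≤ Real.exp (-(m * (2 ^ j * s) / 2)) := by
    intro j
    induction j with
    | zero =>
      simp only [pow_zero, one_mul]
      have := Real.add_one_le_exp (-(m * s / 2))
      linarith
    | succ j ih =>
      have h1 := uniformBody_add_two_smul_le_sq hK hc h0 (((2 : ℝ) ^ j * s) • θ)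
      rw [smul_smul, ← mul_assoc, ← pow_succ'] at h1
      refine h1.trans ((pow_le_pow_left₀ measureReal_nonneg ih 2).trans_eq ?_)
      rw [← Real.exp_nat_mul]
      congr 1
      push_cast
      ring
  have hsr : s ≤ r := by
    have : m / 2 * s ≤ 1 := by
      have : 0 ≤ (uniformBody K).real {x | x + s • θ ∈ K} := measureReal_nonneg
      linarith
    refine le_trans ?_ hr
    rw [le_div_iff₀ hm]
    linarith
  obtain ⟨j, hj, hj'⟩ := exists_nat_pow_near ((one_le_div hs).2 hsr) (one_lt_two (α := ℝ))
  rw [le_div_iff₀ hs] at hj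
  rw [div_lt_iff₀ hs, pow_succ] at hj'
  refine (uniformBody_add_smul_anti hK hc θ (by positivity) hj).trans ((hpow j).trans ?_)
  rw [Real.exp_le_exp]
  nlinarith

/-! ### The direction of least concentration -/

/-- The largest average density of the law of `⟪θ, X⟫` on an interval, for `X` uniform in `K`;
equivalently, the essential supremum of the density of that law. -/
noncomputable def concentration {n : ℕ} (K : Set (RSpace n)) (θ : RSpace n) : ENNReal :=
  ⨆ (t : ℝ) (s : ℝ) (_ : 0 < s), uniformBody K (slab θ t s) / ENNReal.ofReal s

theorem concentration_single_ne_top {n : ℕ} {K : Set (RSpace n)} (hK : IsCompact K)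
    (h0 : volume K ≠ 0) (i : Fin n) :
    concentration K (EuclideanSpace.single i 1) ≠ ⊤ := by
  obtain ⟨R, hR⟩ := hK.isBounded.exists_norm_le
  -- slabs orthogonal to a coordinate direction meet `K` inside a coordinate box
  set D : ENNReal := ENNReal.ofReal (2 * R) ^ (n - 1)
  refine ne_top_of_le_ne_top (b := (volume K)⁻¹ * D)
    (ENNReal.mul_ne_top (ENNReal.inv_ne_top.2 h0) (ENNReal.pow_ne_top ENNReal.ofReal_ne_top)) ?_
  refine iSup_le fun t => iSup_le fun s => iSup_le fun hs => ?_
  refine ENNReal.div_le_of_le_mul ?_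
  rw [uniformBody, ProbabilityTheory.cond_apply hK.measurableSet, mul_assoc]
  gcongr
  let B : Set (Fin n → ℝ) := Set.univ.pi
    (Function.update (fun _ => Set.Icc (-R) R) i (Set.Ico t (t + s)))
  have hB : volume B = D * ENNReal.ofReal s := by
    simp only [B]
    rw [volume_pi_pi, ← Finset.mul_prod_erase _ _ (Finset.mem_univ i), mul_comm]
    congr 1
    · rw [Finset.prod_congr rfl (g := fun _ => ENNReal.ofReal (2 * R))]
      · simp [D]
      · intro j hj
        rw [Function.update_of_ne (Finset.ne_of_mem_erase hj), Real.volume_Icc]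
        congr 1
        ring
    · simp
  have hBm : MeasurableSet B := MeasurableSet.univ_pi fun j => by
    rcases eq_or_ne j i with rfl | hj
    · simp
    · simp [Function.update_of_ne hj]
  rw [← hB, ← (PiLp.volume_preserving_ofLp (Fin n)).measure_preimage hBm.nullMeasurableSet]
  refine measure_mono ?_
  rintro x ⟨hx, hxs⟩ j -
  rcases eq_or_ne j i with rfl | hj
  · simpa [slab, EuclideanSpace.inner_single_left] using hxs
  · have := (PiLp.norm_apply_le x j).trans (hR x hx)
    simpa [Function.update_of_ne hj] using abs_le.1 this

theorem ofReal_inv_le_concentration {n : ℕ} {K : Set (RSpace n)} (hK : IsCompact K)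
    (h0 : volume K ≠ 0) {R : ℝ} (hR0 : 0 ≤ R) (hR : ∀ x ∈ K, ‖x‖ ≤ R) {θ : RSpace n}
    (hθ : ‖θ‖ = 1) : ENNReal.ofReal (2 * R + 1)⁻¹ ≤ concentration K θ := by
  have := isProbabilityMeasure_uniformBody hK h0
  have h1 : uniformBody K (slab θ (-R) (2 * R + 1)) = 1 := by
    have hsub : K ⊆ slab θ (-R) (2 * R + 1) := fun x hx => by
      have h2 := abs_le.1 (abs_real_inner_le_norm θ x)
      rw [hθ, one_mul] at h2
      have := hR x hx
      exact ⟨by linarith, by linarith⟩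
    rw [uniformBody, ProbabilityTheory.cond_apply hK.measurableSet,
      Set.inter_eq_left.2 hsub, ENNReal.inv_mul_cancel h0 hK.measure_lt_top.ne]
  refine le_trans ?_ (le_iSup_of_le (-R) (le_iSup_of_le (2 * R + 1)
    (le_iSup_of_le (by positivity) le_rfl)))
  rw [h1, ENNReal.ofReal_inv_of_pos (by positivity), one_div]

/-- There is a direction `e` whose slabs have density at most `m`, while every other direction has
a slab of density at least `m / 2`. -/
theorem exists_direction {n : ℕ} (hn : 1 ≤ n) {K : Set (RSpace n)} (hK : IsCompact K)
    (h0 : volume K ≠ 0) :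
    ∃ (e : RSpace n) (m : ℝ), ‖e‖ = 1 ∧ 0 < m ∧
      (∀ t s : ℝ, 0 ≤ s → (uniformBody K) (slab e t s) ≤ ENNReal.ofReal (m * s)) ∧
      ∀ θ : RSpace n, ‖θ‖ = 1 →
        ∃ t s : ℝ, 0 < s ∧ m / 2 * s ≤ (uniformBody K).real (slab θ t s) := by
  have := isProbabilityMeasure_uniformBody hK h0
  obtain ⟨R, hR⟩ := hK.isBounded.exists_norm_le
  set M : ENNReal := ⨅ θ : UnitSphere n, concentration K θ with hM
  have hM0 : M ≠ 0 := by
    refine (lt_of_lt_of_le ?_ (le_iInf fun θ : UnitSphere n =>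
      ofReal_inv_le_concentration hK h0 (R := max R 0) (le_max_right _ _)
        (fun x hx => (hR x hx).trans (le_max_left _ _)) (by simp))).ne'
    rw [ENNReal.ofReal_pos]
    positivity
  have hMt : M ≠ ⊤ := ne_top_of_le_ne_top (concentration_single_ne_top hK h0 ⟨0, hn⟩)
    (iInf_le (fun θ : UnitSphere n => concentration K θ) ⟨EuclideanSpace.single ⟨0, hn⟩ 1, by simp⟩)
  obtain ⟨e, he⟩ : ∃ e : UnitSphere n, concentration K e < 2 * M := by
    rw [← iInf_lt_iff, ← hM, two_mul]
    exact ENNReal.lt_add_right hMt hM0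
  have het : concentration K e ≠ ⊤ := he.ne_top
  have hMe : M ≤ concentration K e := iInf_le _ e
  refine ⟨e, (concentration K e).toReal, by simp,
    ENNReal.toReal_pos (fun h => hM0 (by simpa [h] using hMe)) het, ?_, ?_⟩
  · intro t s hs
    rcases hs.eq_or_lt with rfl | hs
    · simp [slab]
    rw [ENNReal.ofReal_mul ENNReal.toReal_nonneg, ENNReal.ofReal_toReal het,
      ← ENNReal.div_le_iff (by simpa using hs) (by simp)]
    exact le_iSup_of_le t (le_iSup_of_le s (le_iSup_of_le hs le_rfl))
  · intro θ hθ
    have h1 : concentration K e / 2 < concentration K θ := by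
      refine lt_of_lt_of_le ?_ (iInf_le (fun θ : UnitSphere n => concentration K θ) ⟨θ, by simpa⟩)
      rwa [ENNReal.div_lt_iff (by simp) (by simp), mul_comm]
    simp only [concentration, lt_iSup_iff] at h1
    obtain ⟨t, s, hs, h2⟩ := h1
    refine ⟨t, s, hs, ?_⟩
    rw [ENNReal.lt_div_iff_mul_lt (by simp [hs]) (by simp)] at h2
    have h3 := ENNReal.toReal_mono (measure_ne_top _ _) h2.le
    rwa [ENNReal.toReal_mul, ENNReal.toReal_div, ENNReal.toReal_ofReal hs.le] at h3

/-! ### The uniform distribution on the sphere -/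

theorem isProbabilityMeasure_uniformSphere {n : ℕ} (hn : 1 ≤ n) :
    IsProbabilityMeasure (uniformSphere n) := by
  have : Nonempty (Fin n) := ⟨⟨0, hn⟩⟩
  exact ProbabilityTheory.cond_isProbabilityMeasure
    ((Measure.measure_univ_ne_zero).2 (Measure.toSphere_ne_zero _))

/-- The action of a linear isometry on the unit sphere. -/
noncomputable def sphereMap {n : ℕ} (T : RSpace n ≃ₗᵢ[ℝ] RSpace n) (θ : UnitSphere n) :
    UnitSphere n :=
  ⟨T θ, by simp⟩

open scoped Pointwise in
theorem measurePreserving_sphereMap {n : ℕ} (T : RSpace n ≃ₗᵢ[ℝ] RSpace n) :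
    MeasurePreserving (sphereMap T) (uniformSphere n) (uniformSphere n) := by
  have hmeas : Measurable (sphereMap T) :=
    ((T.continuous.comp continuous_subtype_val).subtype_mk _).measurable
  have h : MeasurePreserving (sphereMap T) (volume : Measure (RSpace n)).toSphere
      (volume : Measure (RSpace n)).toSphere := by
    refine ⟨hmeas, Measure.ext fun s hs => ?_⟩
    rw [Measure.map_apply hmeas hs, Measure.toSphere_apply' _ hs,
      Measure.toSphere_apply' _ (hmeas hs),
      ← T.measurePreserving.measure_preimage_equiv (f := T.toMeasurableEquiv)
        (Set.Ioo (0 : ℝ) 1 • (Subtype.val '' s))]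
    congr 2
    ext x
    simp only [Set.mem_smul, Set.mem_image, Set.mem_preimage]
    constructor
    · rintro ⟨c, hc, _, ⟨θ, hθ, rfl⟩, rfl⟩
      exact ⟨c, hc, _, ⟨_, hθ, rfl⟩, by simp [sphereMap]⟩
    · rintro ⟨c, hc, _, ⟨θ, hθ, rfl⟩, hx⟩
      refine ⟨c, hc, _, ⟨sphereMap T.symm θ, ?_, rfl⟩, ?_⟩
      · simpa [sphereMap] using hθ
      · apply T.injective
        simpa [sphereMap] using hx
  rw [uniformSphere, ProbabilityTheory.cond, Measure.restrict_univ]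
  exact h.smul_measure _

/-- The second moment of a coordinate of a uniform point of the sphere: by symmetry the moments in
the `n` directions of an orthonormal basis agree, and they add up to `1`. -/
theorem lintegral_inner_sq_uniformSphere {n : ℕ} (hn : 1 ≤ n) {e : RSpace n} (he : ‖e‖ = 1) :
    ∫⁻ θ, ENNReal.ofReal (inner ℝ e (θ : RSpace n) ^ 2) ∂uniformSphere n = (n : ENNReal)⁻¹ := by
  have := isProbabilityMeasure_uniformSphere hn
  have hm : ∀ v : RSpace n, Measurable fun θ : UnitSphere n =>
      ENNReal.ofReal (inner ℝ v (θ : RSpace n) ^ 2) := fun v => by fun_prop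
  let i₀ : Fin n := ⟨0, hn⟩
  obtain ⟨b, hb⟩ := Orthonormal.exists_orthonormalBasis_extension_of_card_eq (𝕜 := ℝ)
    (E := RSpace n) (ι := Fin n) (by simp) (v := fun _ => e) (s := {i₀}) (by
      rw [orthonormal_iff_ite]
      rintro ⟨i, rfl⟩ ⟨j, rfl⟩
      simp [he])
  have hbe : b i₀ = e := hb i₀ rfl
  have hinv : ∀ i, ∫⁻ θ, ENNReal.ofReal (inner ℝ (b i) (θ : RSpace n) ^ 2) ∂uniformSphere n
      = ∫⁻ θ, ENNReal.ofReal (inner ℝ e (θ : RSpace n) ^ 2) ∂uniformSphere n := by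
    intro i
    let T : RSpace n ≃ₗᵢ[ℝ] RSpace n := b.equiv b (Equiv.swap i₀ i)
    have hT : T e = b i := by simp [T, ← hbe]
    rw [← (measurePreserving_sphereMap T).lintegral_comp (hm (b i))]
    refine lintegral_congr fun θ => ?_
    simp only [sphereMap]
    rw [← hT, T.inner_map_map]
  have hsum : ∑ i, ∫⁻ θ, ENNReal.ofReal (inner ℝ (b i) (θ : RSpace n) ^ 2) ∂uniformSphere n
      = 1 := by
    rw [← lintegral_finsetSum _ fun i _ => hm (b i)]
    rw [lintegral_congr (g := fun _ => 1), lintegral_one, measure_univ]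
    intro θ
    rw [← ENNReal.ofReal_sum_of_nonneg fun i _ => sq_nonneg _, b.sum_sq_inner_right]
    simp
  rw [Finset.sum_congr rfl fun i _ => hinv i] at hsum
  simp only [Finset.sum_const, Finset.card_univ, Fintype.card_fin, nsmul_eq_mul] at hsum
  exact ENNReal.eq_inv_of_mul_eq_one_left ((mul_comm _ _).trans hsum)

theorem lintegral_abs_inner_uniformSphere_le {n : ℕ} (hn : 1 ≤ n) {e : RSpace n}
    (he : ‖e‖ = 1) :
    ∫⁻ θ, ENNReal.ofReal |inner ℝ e (θ : RSpace n)| ∂uniformSphere n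
      ≤ ENNReal.ofReal (1 / √n) := by
  have := isProbabilityMeasure_uniformSphere hn
  have hn0 : (0 : ℝ) < n := by exact_mod_cast hn
  have hs : 0 < √(n : ℝ) := Real.sqrt_pos.2 hn0
  have hss : √(n : ℝ) * √n = n := Real.mul_self_sqrt hn0.le
  have hpt : ∀ a : ℝ, |a| ≤ √n / 2 * a ^ 2 + 1 / (2 * √n) := by
    intro a
    have h2 : √n / 2 * a ^ 2 + 1 / (2 * √n) - |a| = (√n * |a| - 1) ^ 2 / (2 * √n) := by
      rw [← sq_abs a]
      field_simp
      ring
    have : 0 ≤ (√n * |a| - 1) ^ 2 / (2 * √n) := by positivity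
    linarith
  calc ∫⁻ θ, ENNReal.ofReal |inner ℝ e (θ : RSpace n)| ∂uniformSphere n
      ≤ ∫⁻ θ, (ENNReal.ofReal (√n / 2) * ENNReal.ofReal (inner ℝ e (θ : RSpace n) ^ 2)
          + ENNReal.ofReal (1 / (2 * √n))) ∂uniformSphere n := by
        refine lintegral_mono fun θ => ?_
        simp only
        rw [← ENNReal.ofReal_mul (by positivity),
          ← ENNReal.ofReal_add (by positivity) (by positivity)]
        exact ENNReal.ofReal_le_ofReal (hpt _)
    _ = ENNReal.ofReal (1 / √n) := by
        rw [lintegral_add_right _ measurable_const,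
          lintegral_const_mul' _ _ ENNReal.ofReal_ne_top, lintegral_inner_sq_uniformSphere hn he,
          lintegral_const, measure_univ, mul_one, ← ENNReal.ofReal_natCast,
          ← ENNReal.ofReal_inv_of_pos hn0, ← ENNReal.ofReal_mul (by positivity),
          ← ENNReal.ofReal_add (by positivity) (by positivity)]
        congr 1
        rw [show (n : ℝ)⁻¹ = (√n)⁻¹ * (√n)⁻¹ by rw [← mul_inv, hss]]
        field_simp
        norm_num

/-! ### Lines that miss a hyperplane inside the body -/

/-- The tail function of `⟪e, X⟫` is `m`-Lipschitz by the slab bound, so it takes the value `1 / 2`. -/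
theorem exists_median {n : ℕ} {K : Set (RSpace n)} (hK : IsCompact K) (h0 : volume K ≠ 0)
    {e : RSpace n} {m : ℝ} (he : ‖e‖ = 1) (hm : 0 < m)
    (hslab : ∀ t s : ℝ, 0 ≤ s → (uniformBody K) (slab e t s) ≤ ENNReal.ofReal (m * s)) :
    ∃ t : ℝ, (uniformBody K).real {x | t ≤ inner ℝ e x} = 1 / 2 := by
  have := isProbabilityMeasure_uniformBody hK h0
  obtain ⟨R, hR⟩ := hK.isBounded.exists_norm_le
  have hRe : ∀ x ∈ K, -R ≤ inner ℝ e x ∧ inner ℝ e x ≤ R := fun x hx =>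
    abs_le.1 ((abs_real_inner_le_norm e x).trans (by simpa [he] using hR x hx))
  have hpos : 0 < volume.real K := ENNReal.toReal_pos h0 hK.measure_lt_top.ne
  set F : ℝ → ℝ := fun t => (uniformBody K).real {x | t ≤ inner ℝ e x}
  have hanti : Antitone F := fun a b hab => measureReal_mono fun x hx => hab.trans hx
  have hF : ∀ a b, a ≤ b → F a ≤ F b + m * (b - a) := by
    intro a b hab
    have h1 : (uniformBody K).real (slab e a (b - a)) ≤ m * (b - a) := by
      refine ENNReal.toReal_le_of_le_ofReal ?_ (hslab a (b - a) (by linarith))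
      exact mul_nonneg hm.le (by linarith)
    have h2 : F a ≤ F b + (uniformBody K).real (slab e a (b - a)) := by
      refine (measureReal_mono ?_).trans (measureReal_union_le _ _)
      intro x (hx : a ≤ inner ℝ e x)
      rcases le_or_gt b (inner ℝ e x) with h | h
      · exact Or.inl h
      · exact Or.inr ⟨hx, by linarith⟩
    linarith
  have hcont : Continuous F := by
    refine (LipschitzWith.of_dist_le_mul (K := m.toNNReal) fun a b => ?_).continuous
    rw [Real.dist_eq, Real.dist_eq, Real.coe_toNNReal m hm.le]
    wlog hab : a ≤ b generalizing a b
    · rw [abs_sub_comm, abs_sub_comm a]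
      exact this b a (le_of_not_ge hab)
    rw [abs_of_nonneg (sub_nonneg.2 (hanti hab)), abs_of_nonpos (by linarith)]
    have := hF a b hab
    linarith
  have hlow : F (-R) = 1 := by
    have hsub : K ⊆ {x | -R ≤ inner ℝ e x} := fun x hx => (hRe x hx).1
    simp only [F]
    rw [uniformBody_real_apply hK.measurableSet, Set.inter_eq_left.2 hsub,
      inv_mul_cancel₀ hpos.ne']
  have hhigh : F (R + 1) = 0 := by
    simp only [F]
    have : K ∩ {x | R + 1 ≤ inner ℝ e x} = ∅ := by
      ext x
      simp only [Set.mem_inter_iff, Set.mem_ofPred_eq, Set.mem_empty_iff_false, iff_false, not_and]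
      intro hx h
      have := (hRe x hx).2
      linarith
    rw [uniformBody_real_apply hK.measurableSet, this]
    simp
  exact mem_range_of_exists_le_of_exists_ge hcont ⟨R + 1, hhigh.trans_le (by norm_num)⟩
    ⟨-R, le_trans (by norm_num) hlow.ge⟩

theorem length_lineThrough_inter_ne_top {n : ℕ} {K : Set (RSpace n)} (hK : IsCompact K)
    {x θ : RSpace n} (hθ : ‖θ‖ = 1) : length (lineThrough x θ ∩ K) ≠ ⊤ := by
  obtain ⟨R, hR⟩ := hK.isBounded.exists_norm_le
  set D := R + ‖x‖
  have hsub : lineThrough x θ ∩ K ⊆ segment ℝ (x + (-D) • θ) (x + D • θ) := by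
    rintro _ ⟨⟨u, rfl⟩, hu⟩
    have h1 : |u| ≤ D := by
      have h2 : ‖u • θ‖ ≤ ‖x + u • θ‖ + ‖x‖ := by
        simpa using norm_sub_le (x + u • θ) x
      rw [norm_smul, hθ, mul_one, Real.norm_eq_abs] at h2
      have := hR _ hu
      simp only at this
      linarith
    obtain ⟨h2, h3⟩ := abs_le.1 h1
    have hu' : u ∈ segment ℝ (-D) D := by
      rw [segment_eq_Icc (by linarith)]
      exact ⟨h2, h3⟩
    obtain ⟨a, b, ha, hb, hab, rfl⟩ := hu'
    refine ⟨a, b, ha, hb, hab, ?_⟩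
    have hx : x = (a + b) • x := by rw [hab, one_smul]
    simp only [smul_eq_mul]
    nth_rewrite 3 [hx]
    module
  refine ne_top_of_le_ne_top ?_ (measure_mono hsub)
  rw [hausdorffMeasure_segment]
  exact edist_ne_top _ _

/-- If the line through `x` leaves the body within distance `r` of `x` on both sides, and `x` is
further from the hyperplane `⟪e, ·⟫ = t` than the height gained along such a piece of line, then
the hyperplane does not cut the chord. -/
theorem mem_zeroOneEvent {n : ℕ} {K : Set (RSpace n)} (hK : IsCompact K) (hc : Convex ℝ K)
    {e x : RSpace n} {θ : UnitSphere n} {t r : ℝ} (hr : 0 < r) (hx : x ∈ K)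
    (h1 : x + r • (θ : RSpace n) ∉ K) (h2 : x + r • (-(θ : RSpace n)) ∉ K)
    (h3 : x ∉ slab e (t - r * |inner ℝ e (θ : RSpace n)|) (2 * (r * |inner ℝ e (θ : RSpace n)|))) :
    (x, θ) ∈ zeroOneEvent K (K ∩ {y | t ≤ inner ℝ e y}) := by
  have hexit : ∀ (v : RSpace n) (u : ℝ), x + r • v ∉ K → x + u • v ∈ K → u < r := by
    intro v u hv hu
    by_contra! hru
    have hu0 : 0 < u := hr.trans_le hru
    have := hc.add_smul_mem hx hu (t := r / u) ⟨by positivity, (div_le_one hu0).2 hru⟩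
    rw [smul_smul, div_mul_cancel₀ _ hu0.ne'] at this
    exact hv this
  have hheight : ∀ u : ℝ, x + u • (θ : RSpace n) ∈ K →
      |inner ℝ e (x + u • (θ : RSpace n)) - inner ℝ e x| ≤ r * |inner ℝ e (θ : RSpace n)| := by
    intro u hu
    have hu1 : u < r := hexit θ u h1 hu
    have hu2 : -u < r := hexit (-θ) (-u) h2 (by simpa using hu)
    rw [inner_add_right, inner_smul_right, add_sub_cancel_left, abs_mul]
    gcongr
    exact abs_le.2 ⟨by linarith, hu1.le⟩
  simp only [zeroOneEvent, Set.mem_ofPred_eq]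
  simp only [slab, Set.mem_ofPred_eq, Set.mem_Ico, not_and_or, not_le, not_lt] at h3
  rcases h3 with h3 | h3
  · have : lineThrough x θ ∩ (K ∩ {y | t ≤ inner ℝ e y}) = ∅ := by
      refine Set.eq_empty_iff_forall_notMem.2 ?_
      rintro _ ⟨⟨u, rfl⟩, hu, hut⟩
      have h4 := (abs_le.1 (hheight u hu)).2
      simp only [Set.mem_ofPred_eq] at hut
      linarith
    rw [this]
    left
    simp [length]
  · have : lineThrough x θ ∩ (K ∩ {y | t ≤ inner ℝ e y}) = lineThrough x θ ∩ K := by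
      refine Set.Subset.antisymm (by gcongr; exact Set.inter_subset_left) ?_
      rintro _ ⟨⟨u, rfl⟩, hu⟩
      have h4 := (abs_le.1 (hheight u hu)).1
      refine ⟨⟨u, rfl⟩, hu, ?_⟩
      simp only [Set.mem_ofPred_eq] at *
      linarith
    rw [this]
    rcases eq_or_ne (length (lineThrough x θ ∩ K)) 0 with h | h
    · left; simp [h]
    · right
      exact ENNReal.div_self h (length_lineThrough_inter_ne_top hK (by simp))

theorem prod_apply_le_of_forall_le {α β : Type*} [MeasurableSpace α] [MeasurableSpace β]
    {μ : Measure α} {ν : Measure β} [SFinite μ] [IsProbabilityMeasure ν] {S : Set (α × β)}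
    (hS : MeasurableSet S) {c : ENNReal} (h : ∀ y, μ {x | (x, y) ∈ S} ≤ c) :
    μ.prod ν S ≤ c := by
  rw [Measure.prod_apply_symm hS]
  calc ∫⁻ y, μ ((fun x => (x, y)) ⁻¹' S) ∂ν ≤ ∫⁻ _, c ∂ν := lintegral_mono h
    _ = c := by simp

theorem one_sub_le_real_zeroOneEvent {n : ℕ} (hn : 1 ≤ n) {K : Set (RSpace n)}
    (hK : IsCompact K) (hc : Convex ℝ K) (h0 : volume K ≠ 0) {e : RSpace n} {m : ℝ}
    (he : ‖e‖ = 1) (hm : 0 < m)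
    (hslab : ∀ t s : ℝ, 0 ≤ s → (uniformBody K) (slab e t s) ≤ ENNReal.ofReal (m * s))
    (hdir : ∀ θ : RSpace n, ‖θ‖ = 1 →
      ∃ t s : ℝ, 0 < s ∧ m / 2 * s ≤ (uniformBody K).real (slab θ t s)) (t : ℝ) :
    1 - 10 * (1 + Real.log n) / √n ≤
      (hitAndRunLaw K).real (zeroOneEvent K (K ∩ {y | t ≤ inner ℝ e y})) := by
  have := isProbabilityMeasure_uniformBody hK h0
  have := isProbabilityMeasure_uniformSphere hn
  have hKm := hK.measurableSet
  have hn1 : (1 : ℝ) ≤ n := by exact_mod_cast hn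
  have hs : 0 < √(n : ℝ) := Real.sqrt_pos.2 (by linarith)
  set ℓ := 1 + Real.log n with hℓ
  have hℓ1 : 1 ≤ ℓ := by have := Real.log_nonneg hn1; linarith
  -- beyond this distance the exponential tail of the chord length is below `1 / n`
  set r := 4 / m * ℓ with hr
  have hr0 : 0 < r := by positivity
  have hmr : m * r = 4 * ℓ := by rw [hr]; field_simp
  have hr2 : 2 / m ≤ r := by
    rw [div_le_iff₀ hm]
    linarith
  have htail : ∀ θ : RSpace n, ‖θ‖ = 1 →
      uniformBody K {x | x + r • θ ∈ K} ≤ ENNReal.ofReal (ℓ / √n) := by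
    intro θ hθ
    obtain ⟨u, s, hs', hus⟩ := hdir θ hθ
    have h1 := uniformBody_add_smul_le_exp hK hc h0 hθ hm hs' hus hr2
    rw [← ofReal_measureReal (measure_ne_top _ _)]
    refine ENNReal.ofReal_le_ofReal (h1.trans ?_)
    have h2 : -(m * r / 4) ≤ -Real.log n := by rw [hmr]; linarith
    refine (Real.exp_le_exp.2 h2).trans ?_
    rw [Real.exp_neg, Real.exp_log (by linarith), ← one_div]
    refine div_le_div₀ (by linarith) hℓ1 hs ?_
    rw [Real.sqrt_le_left (by linarith)]
    nlinarith
  let ρ : UnitSphere n → ℝ := fun θ => r * |inner ℝ e (θ : RSpace n)|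
  let B₁ : Set (RSpace n × UnitSphere n) := {p | p.1 ∈ slab e (t - ρ p.2) (2 * ρ p.2)}
  let B₂ : Set (RSpace n × UnitSphere n) := {p | p.1 + r • (p.2 : RSpace n) ∈ K}
  let B₃ : Set (RSpace n × UnitSphere n) := {p | p.1 + r • (-(p.2 : RSpace n)) ∈ K}
  have hB₁ : MeasurableSet B₁ := by
    have hρ : Measurable fun p : RSpace n × UnitSphere n => ρ p.2 := by
      simp only [ρ]; fun_prop
    have hin : Measurable fun p : RSpace n × UnitSphere n => inner ℝ e p.1 := by fun_prop
    exact (measurableSet_le (measurable_const.sub hρ) hin).inter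
      (measurableSet_lt hin ((measurable_const.sub hρ).add (hρ.const_mul 2)))
  have hB₂ : MeasurableSet B₂ :=
    (by fun_prop : Measurable fun p : RSpace n × UnitSphere n => p.1 + r • (p.2 : RSpace n)) hKm
  have hB₃ : MeasurableSet B₃ :=
    (by fun_prop : Measurable fun p : RSpace n × UnitSphere n => p.1 + r • (-(p.2 : RSpace n))) hKm
  have h1 : hitAndRunLaw K B₁ ≤ ENNReal.ofReal (8 * ℓ / √n) := by
    rw [hitAndRunLaw, Measure.prod_apply_symm hB₁]
    calc ∫⁻ θ, uniformBody K ((fun x => (x, θ)) ⁻¹' B₁) ∂uniformSphere n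
        ≤ ∫⁻ θ, ENNReal.ofReal (8 * ℓ) * ENNReal.ofReal |inner ℝ e (θ : RSpace n)|
            ∂uniformSphere n := by
          refine lintegral_mono fun θ => ?_
          refine (hslab (t - ρ θ) (2 * ρ θ) (by positivity)).trans_eq ?_
          rw [← ENNReal.ofReal_mul (by positivity)]
          congr 1
          simp only [ρ]
          linear_combination (2 * |inner ℝ e (θ : RSpace n)|) * hmr
      _ ≤ ENNReal.ofReal (8 * ℓ) * ENNReal.ofReal (1 / √n) := by
          rw [lintegral_const_mul' _ _ ENNReal.ofReal_ne_top]
          gcongr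
          exact lintegral_abs_inner_uniformSphere_le hn he
      _ = ENNReal.ofReal (8 * ℓ / √n) := by
          rw [← ENNReal.ofReal_mul (by positivity)]
          congr 1
          ring
  have h2 : hitAndRunLaw K B₂ ≤ ENNReal.ofReal (ℓ / √n) :=
    prod_apply_le_of_forall_le hB₂ fun θ => htail θ (by simp)
  have h3 : hitAndRunLaw K B₃ ≤ ENNReal.ofReal (ℓ / √n) :=
    prod_apply_le_of_forall_le hB₃ fun θ => htail (-θ) (by simp)
  have h4 : hitAndRunLaw K {p | p.1 ∉ K} ≤ 0 := by
    refine prod_apply_le_of_forall_le (measurable_fst hKm.compl) fun θ => ?_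
    rw [uniformBody, ProbabilityTheory.cond_apply hKm]
    have : K ∩ {x | x ∉ K} = ∅ := by ext; simp
    simp [this]
  have hP : IsProbabilityMeasure (hitAndRunLaw K) := by
    unfold hitAndRunLaw; infer_instance
  have r1 := ENNReal.toReal_le_of_le_ofReal (by positivity) h1
  have r2 := ENNReal.toReal_le_of_le_ofReal (by positivity) h2
  have r3 := ENNReal.toReal_le_of_le_ofReal (by positivity) h3
  have r4 : (hitAndRunLaw K).real {p | p.1 ∉ K} = 0 := by
    rw [measureReal_def, nonpos_iff_eq_zero.1 h4]; rfl
  set Z := zeroOneEvent K (K ∩ {y | t ≤ inner ℝ e y})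
  have hcover : (Set.univ : Set (RSpace n × UnitSphere n))
      ⊆ Z ∪ (B₁ ∪ (B₂ ∪ (B₃ ∪ {p | p.1 ∉ K}))) := by
    rintro ⟨x, θ⟩ -
    by_contra hcon
    simp only [Set.mem_union, not_or, Set.mem_ofPred_eq, not_not] at hcon
    obtain ⟨hZ, g1, g2, g3, hx⟩ := hcon
    exact hZ (mem_zeroOneEvent hK hc hr0 hx g2 g3 g1)
  have hone := measureReal_mono (μ := hitAndRunLaw K) hcover
  rw [probReal_univ] at hone
  have u1 := measureReal_union_le (μ := hitAndRunLaw K) Z (B₁ ∪ (B₂ ∪ (B₃ ∪ {p | p.1 ∉ K})))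
  have u2 := measureReal_union_le (μ := hitAndRunLaw K) B₁ (B₂ ∪ (B₃ ∪ {p | p.1 ∉ K}))
  have u3 := measureReal_union_le (μ := hitAndRunLaw K) B₂ (B₃ ∪ {p | p.1 ∉ K})
  have u4 := measureReal_union_le (μ := hitAndRunLaw K) B₃ {p | p.1 ∉ K}
  rw [← measureReal_def] at r1 r2 r3
  have hsum : 10 * ℓ / √n = 8 * ℓ / √n + ℓ / √n + ℓ / √n := by ring
  linarith

theorem theorem1p2 :
    ∃ (C : ℝ) (k : ℕ), 0 < C ∧
      ∀ (n : ℕ), 1 ≤ n → ∀ K : ConvexBody (RSpace n), (interior (K : Set (RSpace n))).Nonempty →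
        ∃ A : Set (RSpace n), A ⊆ (K : Set (RSpace n)) ∧ MeasurableSet A ∧
          volume A / volume (K : Set (RSpace n)) = 1 / 2 ∧
          |(hitAndRunLaw (K : Set (RSpace n))).real (zeroOneEvent (K : Set (RSpace n)) A) - 1|
            ≤ C * (1 + Real.log n) ^ k / √n := by
  refine ⟨10, 1, by norm_num, fun n hn K hint => ?_⟩
  have hK := K.isCompact
  have h0 : volume (K : Set (RSpace n)) ≠ 0 := (Measure.measure_pos_of_nonempty_interior _ hint).ne'
  have := isProbabilityMeasure_uniformBody hK h0
  have := isProbabilityMeasure_uniformSphere hn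
  obtain ⟨e, m, he, hm, hslab, hdir⟩ := exists_direction hn hK h0
  obtain ⟨t, ht⟩ := exists_median hK h0 he hm hslab
  refine ⟨K ∩ {y | t ≤ inner ℝ e y}, Set.inter_subset_left,
    hK.measurableSet.inter (measurableSet_le measurable_const (by fun_prop)), ?_, ?_⟩
  · have h1 : uniformBody (K : Set (RSpace n)) {y | t ≤ inner ℝ e y} = ENNReal.ofReal (1 / 2) := by
      rw [← ht, ofReal_measureReal (measure_ne_top _ _)]
    rw [uniformBody, ProbabilityTheory.cond_apply hK.measurableSet] at h1
    rw [ENNReal.div_eq_inv_mul, h1]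
    simp
  · have hP : IsProbabilityMeasure (hitAndRunLaw (K : Set (RSpace n))) := by
      unfold hitAndRunLaw; infer_instance
    rw [pow_one, abs_sub_comm, abs_of_nonneg (sub_nonneg.2 measureReal_le_one)]
    have := one_sub_le_real_zeroOneEvent hn hK K.convex h0 he hm hslab hdir t
    linarith
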